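/- Let $\kappa>0$ and $\rho\in\mathbb{R}$, and let $W^r$ and $W^S$ be standard Brownian motions with respect to a common filtration $(\mathcal{F}_t)_{t\ge 0}$ on a probability space, with correlation $\rho$, that is, $d\langle W^S,W^r\rangle_t=\rho\,dt$. Let $R$ be the Vasicek process, the solution (adapted, with continuous paths) of $$dR_t=-\kappa R_t\,dt+dW^r_t,\qquad R_0=0,$$ and let $I_t=\int_0^t R_s\,ds$. Then, for every $t>0$ and every $\Delta t>0$, the conditional law given $R_t$ of the vector of increments is jointly Gaussian: $$\begin{pmatrix}R_{t+\Delta t}-R_t\\ I_{t+\Delta t}-I_t\\ W^S_{t+\Delta t}-W^S_t\end{pmatrix}\Big|\,R_t\ \sim\ \mathcal{N}\left(\begin{pmatrix}\mu_R\\ \mu_I\\ \mu_W\end{pmatrix},\begin{pmatrix}\sigma_R^2&\sigma_{R,I}&\sigma_{R,W}\\ \sigma_{R,I}&\sigma_I^2&\sigma_{I,W}\\ \sigma_{R,W}&\sigma_{I,W}&\sigma_W^2\end{pmatrix}\right),$$ where the matrix is symmetric positive semidefinite and $$\mu_R=R_t\left(e^{-\kappa\Delta t}-1\right),\qquad \mu_I=-\frac{\mu_R}{\kappa},\qquad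 \mu_W=0,$$ $$\sigma_R^2=\frac{1}{2\kappa}\left(1-e^{-2\kappa\Delta t}\right),\qquad \sigma_I^2=\frac{1}{2\kappa^3}\left(2\kappa\Delta t+4e^{-\kappa\Delta t}-e^{-2\kappa\Delta t}-3\right),\qquad \sigma_W^2=\Delta t,$$ $$\sigma_{R,I}=\frac{1}{2\kappa^2}\left(1-e^{-\kappa\Delta t}\right)^2,\qquad \sigma_{R,W}=\frac{\rho}{\kappa}\left(1-e^{-\kappa\Delta t}\right),\qquad \sigma_{I,W}=\frac{\rho}{\kappa^2}\left(\kappa\Delta t+e^{-\kappa\Delta t}-1\right).$$ -/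

import Mathlib

open MeasureTheory ProbabilityTheory
open scoped NNReal Matrix

/-- `W` is a standard Brownian motion relative to the filtration `𝓕`: it is a standard Brownian
motion, it is adapted to `𝓕`, and each increment after time `s` is independent of `𝓕 s`. -/
structure IsBrownianWrt {Ω : Type*} {mΩ : MeasurableSpace Ω} (W : ℝ≥0 → Ω → ℝ)
    (𝓕 : Filtration ℝ≥0 mΩ) (P : Measure Ω) : Prop where
  isBrownian : IsBrownianReal W P
  adapted : StronglyAdapted 𝓕 W
  indep : ∀ s t : ℝ≥0, s ≤ t →
    Indep (MeasurableSpace.comap (fun ω ↦ W t ω - W s ω) inferInstance) (𝓕 s) P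

/-- `A` is the angle bracket `⟨M, N⟩` of two continuous square-integrable martingales `M`, `N`:
the adapted process, null at time `0`, with continuous paths of locally bounded variation, such
that `M N - A` is a martingale. -/
structure IsAngleBracket {Ω : Type*} {mΩ : MeasurableSpace Ω} (M N A : ℝ≥0 → Ω → ℝ)
    (𝓕 : Filtration ℝ≥0 mΩ) (P : Measure Ω) : Prop where
  adapted : StronglyAdapted 𝓕 A
  init : ∀ᵐ ω ∂P, A 0 ω = 0
  cont : ∀ᵐ ω ∂P, Continuous (fun t ↦ A t ω)
  boundedVariation : ∀ᵐ ω ∂P, LocallyBoundedVariationOn (fun t ↦ A t ω) Set.univ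
  martingale : Martingale (fun t ω ↦ M t ω * N t ω - A t ω) 𝓕 P

/-- The time integral `I_t = ∫_0^t R_s ds` of a process `R`, path by path. -/
noncomputable def timeIntegral {Ω : Type*} (R : ℝ≥0 → Ω → ℝ) (t : ℝ≥0) (ω : Ω) : ℝ :=
  ∫ s in (0 : ℝ)..(t : ℝ), R s.toNNReal ω

/-- `R` solves `dR_t = -κ R_t dt + dW_t`, `R_0 = 0`: it is an adapted process with almost surely
continuous paths which satisfies `R_t = R_0 - κ ∫_0^t R_s ds + (W_t - W_0)` for all `t`, almost
surely. The stochastic integral of the constant `1` is the increment `W_t - W_0`. -/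
structure IsVasicekSolution {Ω : Type*} {mΩ : MeasurableSpace Ω} (κ : ℝ) (R W : ℝ≥0 → Ω → ℝ)
    (𝓕 : Filtration ℝ≥0 mΩ) (P : Measure Ω) : Prop where
  adapted : StronglyAdapted 𝓕 R
  cont : ∀ᵐ ω ∂P, Continuous (fun t ↦ R t ω)
  init : ∀ᵐ ω ∂P, R 0 ω = 0
  sde : ∀ᵐ ω ∂P, ∀ t : ℝ≥0, R t ω = R 0 ω - κ * timeIntegral R t ω + (W t ω - W 0 ω)

/-- The vector of the increments over `[t, t + Δ]` of `R`, of its time integral and of `W`. -/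
noncomputable def incrementVector {Ω : Type*} (R W : ℝ≥0 → Ω → ℝ) (t Δ : ℝ≥0) (ω : Ω) :
    EuclideanSpace ℝ (Fin 3) :=
  !₂[R (t + Δ) ω - R t ω, timeIntegral R (t + Δ) ω - timeIntegral R t ω, W (t + Δ) ω - W t ω]

/-- The conditional mean of the increments, given that `R_t = x`: the vector `(μ_R, μ_I, μ_W)`. -/
noncomputable def condMean (κ Δ x : ℝ) : EuclideanSpace ℝ (Fin 3) :=
  !₂[x * (Real.exp (-κ * Δ) - 1), -(x * (Real.exp (-κ * Δ) - 1)) / κ, 0]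

/-- The conditional covariance matrix of the increments. -/
noncomputable def condCov (κ ρ Δ : ℝ) : Matrix (Fin 3) (Fin 3) ℝ :=
  let σRR := 1 / (2 * κ) * (1 - Real.exp (-2 * κ * Δ))
  let σII := 1 / (2 * κ ^ 3) *
    (2 * κ * Δ + 4 * Real.exp (-κ * Δ) - Real.exp (-2 * κ * Δ) - 3)
  let σWW := Δ
  let σRI := 1 / (2 * κ ^ 2) * (1 - Real.exp (-κ * Δ)) ^ 2
  let σRW := ρ / κ * (1 - Real.exp (-κ * Δ))
  let σIW := ρ / κ ^ 2 * (κ * Δ + Real.exp (-κ * Δ) - 1)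
  !![σRR, σRI, σRW;
     σRI, σII, σIW;
     σRW, σIW, σWW]

theorem measurable_condMean (κ Δ : ℝ) : Measurable (condMean κ Δ) := by
  unfold condMean
  refine (WithLp.measurable_toLp 2 (Fin 3 → ℝ)).comp (measurable_pi_lambda _ fun i ↦ ?_)
  fin_cases i <;> simp <;> fun_prop

open scoped MatrixOrder in
theorem measurable_multivariateGaussian_mean (S : Matrix (Fin 3) (Fin 3) ℝ) :
    Measurable fun m : EuclideanSpace ℝ (Fin 3) ↦ multivariateGaussian m S := by
  refine Measure.measurable_of_measurable_coe _ fun s hs ↦ ?_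
  have h (m : EuclideanSpace ℝ (Fin 3)) : multivariateGaussian m S s =
      stdGaussian (EuclideanSpace ℝ (Fin 3)) (Prod.mk m ⁻¹'
        ((fun p : EuclideanSpace ℝ (Fin 3) × EuclideanSpace ℝ (Fin 3) ↦
          p.1 + Matrix.toEuclideanCLM (𝕜 := ℝ) (CFC.sqrt S) p.2) ⁻¹' s)) := by
    rw [multivariateGaussian, Measure.map_apply (by fun_prop) hs]
    rfl
  simp_rw [h]
  exact measurable_measure_prodMk_left ((by fun_prop : Measurable _) hs)

/-- The Gaussian transition kernel `x ↦ 𝒩(condMean κ Δ x, condCov κ ρ Δ)` from `ℝ` to `ℝ³`. -/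
noncomputable def gaussianIncrementKernel (κ ρ Δ : ℝ) : Kernel ℝ (EuclideanSpace ℝ (Fin 3)) where
  toFun x := multivariateGaussian (condMean κ Δ x) (condCov κ ρ Δ)
  measurable' := (measurable_multivariateGaussian_mean _).comp (measurable_condMean κ Δ)

instance isMarkovKernel_gaussianIncrementKernel (κ ρ Δ : ℝ) :
    IsMarkovKernel (gaussianIncrementKernel κ ρ Δ) where
  isProbabilityMeasure x :=
    inferInstanceAs (IsProbabilityMeasure
      (multivariateGaussian (condMean κ Δ x) (condCov κ ρ Δ)))

/-!
The SDE is linear with additive noise, so variation of constants can be done path by path: over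
`[t, t + Δ]` the increments of `R` and `I` are `condMean κ Δ (R t)` plus Wiener integrals
`∫ f dW^r` of deterministic `C¹` weights, and these integrals make sense pathwise after integration
by parts (`IsVasicekSolution.timeIntegral_increment`, `inner_incrementVector_sub_condMean`). It
remains to show that `∫ f dW^r + b ∫ dW^S` is independent of `𝓕 t` and Gaussian, with variance
`∫ (f² + 2ρ b f + b²)`.

This is a Lévy-type characterisation of correlated Brownian motions: joint Gaussianity of
`(W^r, W^S)` is not assumed, only the angle bracket is known. It is proved without stochastic
calculus. Given the past, an increment `ξ = a ΔW^r + b ΔW^S` over a time `δ` has mean zero, variance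
`(a² + 2ρab + b²) δ` (the mixed term comes from the martingale `W^S W^r - ρ t`), and a third absolute
moment `O(δ^{3/2})`, because each of the two Brownian increments is separately Gaussian. Expanding
`exp(iξ)` to second order therefore replaces it by `exp(-(a² + 2ρab + b²) δ / 2)` at a cost
`O(δ^{3/2})`, and replacing the `n` steps of a uniform partition one after the other costs
`n · O(n^{-3/2})`, which vanishes in the limit (`exists_norm_integral_mul_cexp_sum_sub_le`,
`integral_mul_cexp_wienerIntegral`). Every bounded weight measurable at time `t` is allowed
throughout; taking the characters of `R t` as weights yields the joint characteristic function of
`R t` and the centred increments, which is that of a product measure.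

The variance integral of a general linear combination of the increments equals the quadratic form
of `condCov` (`dotProduct_condCov_mulVec`), and its integrand is nonnegative, being the variance of
`a W^r + b W^S` at time one; so `condCov` is positive semidefinite.
-/

/-! ### Second-order expansion of the characteristic function -/

lemma norm_cexp_mul_I_sub_le (x : ℝ) :
    ‖Complex.exp (x * Complex.I) - (1 + x * Complex.I - (x : ℂ) ^ 2 / 2)‖ ≤ 4 * |x| ^ 3 := by
  have hI : (x * Complex.I) ^ 2 = -(x : ℂ) ^ 2 := by rw [mul_pow, Complex.I_sq]; ring
  rcases le_total |x| 1 with h | h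
  · have h1 := Complex.norm_exp_sub_sum_le_norm_mul_exp (x * Complex.I) 3
    simp only [Finset.sum_range_succ, Finset.sum_range_zero, Nat.factorial, hI] at h1
    have h2 : ‖(x * Complex.I : ℂ)‖ = |x| := by simp
    rw [h2] at h1
    have h3 : Real.exp |x| ≤ 4 :=
      (Real.exp_le_exp.2 h).trans (by linarith [Real.exp_one_lt_d9])
    calc _ ≤ |x| ^ 3 * Real.exp |x| := by convert h1 using 3; push_cast; ring
      _ ≤ |x| ^ 3 * 4 := by gcongr
      _ = _ := by ring
  · calc _ ≤ ‖Complex.exp (x * Complex.I)‖ + ‖1 + x * Complex.I - (x : ℂ) ^ 2 / 2‖ :=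
          norm_sub_le _ _
      _ ≤ 1 + (1 + |x| + |x| ^ 2 / 2) := by
          gcongr
          · rw [Complex.norm_exp_ofReal_mul_I]
          · refine (norm_sub_le _ _).trans (add_le_add ((norm_add_le _ _).trans ?_) ?_) <;> simp
      _ ≤ 4 * |x| ^ 3 := by
          nlinarith [mul_nonneg (abs_nonneg x) (sub_nonneg.2 h),
            mul_nonneg (sq_nonneg |x|) (sub_nonneg.2 h)]

lemma Real.abs_exp_neg_sub_le {x : ℝ} (hx : 0 ≤ x) : |Real.exp (-x) - (1 - x)| ≤ x ^ 2 := by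
  have h1 := Real.add_one_le_exp (-x)
  rw [abs_of_nonneg (by linarith)]
  rcases le_total x 1 with h | h
  · have := (abs_le.1 (Real.abs_exp_sub_one_sub_id_le (x := -x) (by rwa [abs_neg, abs_of_nonneg hx]))).2
    linarith [neg_sq x]
  · have : Real.exp (-x) ≤ 1 := Real.exp_le_one_iff.2 (by linarith)
    nlinarith

/-- A quantitative Lindeberg step: if `ξ` behaves, against the weight `G`, as a centred variable
of variance `v`, then `E[G exp(iξ)]` is `exp(-v/2) E[G]` up to the third absolute moment of `ξ`. -/
lemma norm_integral_mul_cexp_sub_le {Ω : Type*} {mΩ : MeasurableSpace Ω} {P : Measure Ω}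
    [IsProbabilityMeasure P] {G : Ω → ℂ} {ξ : Ω → ℝ} {v m : ℝ}
    (hG : AEStronglyMeasurable G P) (hG1 : ∀ ω, ‖G ω‖ ≤ 1) (hξ : MemLp ξ 3 P) (hv : 0 ≤ v)
    (h1 : ∫ ω, G ω * ξ ω ∂P = 0) (h2 : ∫ ω, G ω * (ξ ω : ℂ) ^ 2 ∂P = v * ∫ ω, G ω ∂P)
    (h3 : ∫ ω, |ξ ω| ^ 3 ∂P ≤ m) :
    ‖∫ ω, G ω * Complex.exp (ξ ω * Complex.I) ∂P - Real.exp (-(v / 2)) * ∫ ω, G ω ∂P‖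
      ≤ 4 * m + (v / 2) ^ 2 := by
  have hGm {f : Ω → ℂ} (hf : Integrable f P) : Integrable (fun ω ↦ G ω * f ω) P :=
    hf.bdd_mul hG (Filter.Eventually.of_forall hG1)
  have iG : Integrable G P := by simpa using hGm (integrable_const (1 : ℂ))
  have i1 : Integrable (fun ω ↦ (ξ ω : ℂ)) P := (hξ.integrable (by norm_num)).ofReal
  have i2 : Integrable (fun ω ↦ (ξ ω : ℂ) ^ 2) P := by
    have := ((hξ.mono_exponent (p := 2) (by norm_num)).integrable_sq).ofReal (𝕜 := ℂ)
    simpa using this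
  have i3 : Integrable (fun ω ↦ |ξ ω| ^ 3) P := by
    simpa using hξ.integrable_norm_pow (p := 3) (by norm_num)
  have hmeas : AEStronglyMeasurable (fun ω ↦ Complex.exp (ξ ω * Complex.I)) P := by
    have := hξ.1.aemeasurable
    exact (by fun_prop : AEMeasurable (fun ω ↦ Complex.exp (ξ ω * Complex.I)) P).aestronglyMeasurable
  have ie : Integrable (fun ω ↦ Complex.exp (ξ ω * Complex.I)) P :=
    Integrable.of_bound hmeas 1 (Filter.Eventually.of_forall fun ω ↦ by
      rw [Complex.norm_exp_ofReal_mul_I])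
  have ip : Integrable (fun ω ↦ 1 + (ξ ω : ℂ) * Complex.I - (ξ ω : ℂ) ^ 2 / 2) P :=
    ((integrable_const _).add (i1.mul_const _)).sub (i2.div_const _)
  have hp : ∫ ω, G ω * (1 + (ξ ω : ℂ) * Complex.I - (ξ ω : ℂ) ^ 2 / 2) ∂P =
      (1 - v / 2) * ∫ ω, G ω ∂P := by
    have e : ∀ ω, G ω * (1 + (ξ ω : ℂ) * Complex.I - (ξ ω : ℂ) ^ 2 / 2) =
        G ω + G ω * ξ ω * Complex.I - G ω * (ξ ω : ℂ) ^ 2 / 2 := fun ω ↦ by ring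
    simp_rw [e]
    have j1 : Integrable (fun ω ↦ G ω * ξ ω * Complex.I) P := (hGm i1).mul_const _
    have j2 : Integrable (fun ω ↦ G ω + G ω * ξ ω * Complex.I) P := iG.add j1
    rw [integral_sub j2 ((hGm i2).div_const _), integral_add iG j1, integral_mul_const, integral_div, h1, h2]
    ring
  have b1 : ‖∫ ω, G ω * Complex.exp (ξ ω * Complex.I) ∂P - (1 - v / 2) * ∫ ω, G ω ∂P‖
      ≤ 4 * m := by
    rw [← hp, ← integral_sub (hGm ie) (hGm ip)]
    refine (norm_integral_le_of_norm_le (i3.const_mul 4)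
      (Filter.Eventually.of_forall fun ω ↦ ?_)).trans ?_
    · rw [← mul_sub, norm_mul]
      exact (mul_le_of_le_one_left (norm_nonneg _) (hG1 ω)).trans (norm_cexp_mul_I_sub_le _)
    · rw [integral_const_mul]; gcongr
  have b2 : ‖(1 - v / 2) * ∫ ω, G ω ∂P - Real.exp (-(v / 2)) * ∫ ω, G ω ∂P‖ ≤ (v / 2) ^ 2 := by
    rw [← sub_mul, norm_mul]
    have n1 : ‖∫ ω, G ω ∂P‖ ≤ 1 := by
      simpa using norm_integral_le_of_norm_le (integrable_const (μ := P) (1 : ℝ))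
        (Filter.Eventually.of_forall hG1)
    refine (mul_le_of_le_one_right (norm_nonneg _) n1).trans ?_
    rw [norm_sub_rev]
    have := Real.abs_exp_neg_sub_le (x := v / 2) (by linarith)
    rw [← Real.norm_eq_abs, ← Complex.norm_real] at this
    simpa using this
  calc _ = ‖(∫ ω, G ω * Complex.exp (ξ ω * Complex.I) ∂P - (1 - v / 2) * ∫ ω, G ω ∂P) +
        ((1 - v / 2) * ∫ ω, G ω ∂P - Real.exp (-(v / 2)) * ∫ ω, G ω ∂P)‖ := by congr 1; ring
    _ ≤ _ := (norm_add_le _ _).trans (add_le_add b1 b2)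

/-! ### Moments of Brownian increments weighted by the past -/

section Increments

variable {Ω : Type*} {mΩ : MeasurableSpace Ω} {P : Measure Ω}
  {𝓕 : Filtration ℝ≥0 mΩ} {W W₁ W₂ : ℝ≥0 → Ω → ℝ} {ρ : ℝ} {u v : ℝ≥0}

lemma IsBrownianWrt.hasLaw_increment (hW : IsBrownianWrt W 𝓕 P) (h : u ≤ v) :
    HasLaw (fun ω ↦ W v ω - W u ω) (gaussianReal 0 (v - u)) P := by
  have := hW.isBrownian.hasLaw_sub v u
  have e : nndist v.1 u.1 = v - u := by
    rw [← NNReal.coe_inj, coe_nndist, Real.dist_eq, NNReal.coe_sub h]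
    exact abs_of_nonneg (sub_nonneg.2 h)
  rwa [e] at this

lemma IsBrownianWrt.memLp_increment (hW : IsBrownianWrt W 𝓕 P) (h : u ≤ v) {p : ENNReal}
    (hp : p ≠ ⊤) : MemLp (fun ω ↦ W v ω - W u ω) p P := by
  have h1 := hW.hasLaw_increment h
  have h2 := memLp_id_gaussianReal' (μ := 0) (v := v - u) p hp
  rw [← h1.map_eq, memLp_map_measure_iff aestronglyMeasurable_id h1.aemeasurable] at h2
  exact h2

lemma IsBrownianWrt.memLp_eval (hW : IsBrownianWrt W 𝓕 P) (u : ℝ≥0) {p : ENNReal}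
    (hp : p ≠ ⊤) : MemLp (W u) p P := by
  have h1 := hW.isBrownian.hasLaw_eval u
  have h2 := memLp_id_gaussianReal' (μ := 0) (v := u) p hp
  rw [← h1.map_eq, memLp_map_measure_iff aestronglyMeasurable_id h1.aemeasurable] at h2
  exact h2

lemma IsBrownianWrt.integral_increment (hW : IsBrownianWrt W 𝓕 P) (h : u ≤ v) :
    ∫ ω, (W v ω - W u ω) ∂P = 0 := by
  rw [(hW.hasLaw_increment h).integral_eq, integral_id_gaussianReal]

lemma IsBrownianWrt.integral_increment_sq (hW : IsBrownianWrt W 𝓕 P) (h : u ≤ v) :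
    ∫ ω, (W v ω - W u ω) ^ 2 ∂P = (v : ℝ) - u := by
  have h1 := (hW.hasLaw_increment h).variance_eq
  rw [variance_id_gaussianReal, variance_of_integral_eq_zero
    (hW.hasLaw_increment h).aemeasurable (hW.integral_increment h)] at h1
  rw [h1, NNReal.coe_sub h]

/-- Brownian scaling of the third absolute moment of an increment. -/
lemma IsBrownianWrt.integral_increment_abs_pow_three (hW : IsBrownianWrt W 𝓕 P) (h : u ≤ v) :
    ∫ ω, |W v ω - W u ω| ^ 3 ∂P =
      √(v - u) ^ 3 * ∫ x, |x| ^ 3 ∂(gaussianReal 0 1) := by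
  have h1 := (hW.hasLaw_increment h).integral_comp (f := fun x ↦ |x| ^ 3)
    (by fun_prop)
  have h2 : gaussianReal 0 (v - u) = (gaussianReal 0 1).map (√(v - u) * ·) := by
    rw [gaussianReal_map_const_mul]
    congr 1
    · simp
    · rw [← NNReal.coe_inj]
      simp [NNReal.coe_sub h, Real.sq_sqrt (sub_nonneg.2 (NNReal.coe_le_coe.2 h))]
  simp only [Function.comp_def] at h1
  rw [h1, h2, integral_map (by fun_prop) (by fun_prop), ← integral_const_mul]
  simp only [abs_mul, mul_pow, abs_of_nonneg (Real.sqrt_nonneg _)]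

/-- Against a weight measurable at time `u`, functions of a later increment factor out. -/
lemma IsBrownianWrt.integral_mul_increment (hW : IsBrownianWrt W 𝓕 P) (h : u ≤ v)
    {X : Ω → ℂ} (hX : StronglyMeasurable[𝓕 u] X) {f : ℝ → ℂ} (hf : Measurable f) :
    ∫ ω, X ω * f (W v ω - W u ω) ∂P = (∫ ω, X ω ∂P) * ∫ ω, f (W v ω - W u ω) ∂P := by
  have hXW : IndepFun X (fun ω ↦ W v ω - W u ω) P :=
    indep_of_indep_of_le_left (hW.indep u v h).symm hX.measurable.comap_le
  exact hXW.integral_fun_comp_mul_comp (f := id) (hX.mono (𝓕.le u)).measurable.aemeasurable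
    (hW.hasLaw_increment h).aemeasurable aestronglyMeasurable_id hf.aestronglyMeasurable

lemma IsBrownianWrt.integral_mul_increment_eq_zero (hW : IsBrownianWrt W 𝓕 P) (h : u ≤ v)
    {X : Ω → ℂ} (hX : StronglyMeasurable[𝓕 u] X) :
    ∫ ω, X ω * ((W v ω - W u ω : ℝ) : ℂ) ∂P = 0 := by
  rw [hW.integral_mul_increment h hX (f := fun x ↦ (x : ℂ)) (by fun_prop), integral_complex_ofReal,
    hW.integral_increment h]
  simp

lemma IsBrownianWrt.integral_mul_increment_sq (hW : IsBrownianWrt W 𝓕 P) (h : u ≤ v)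
    {X : Ω → ℂ} (hX : StronglyMeasurable[𝓕 u] X) :
    ∫ ω, X ω * ((W v ω - W u ω : ℝ) : ℂ) ^ 2 ∂P = ((v : ℝ) - u : ℝ) * ∫ ω, X ω ∂P := by
  rw [hW.integral_mul_increment h hX (f := fun x ↦ (x : ℂ) ^ 2) (by fun_prop),
    ← hW.integral_increment_sq h, ← integral_complex_ofReal]
  simp [mul_comm]

lemma MeasureTheory.Martingale.integral_mul_increment_eq_zero [IsFiniteMeasure P] {M : ℝ≥0 → Ω → ℝ}
    (hM : Martingale M 𝓕 P) (h : u ≤ v) {X : Ω → ℂ} (hX : StronglyMeasurable[𝓕 u] X)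
    (hX1 : ∀ ω, ‖X ω‖ ≤ 1) :
    ∫ ω, X ω * ((M v ω - M u ω : ℝ) : ℂ) ∂P = 0 := by
  have hi : Integrable (M v - M u) P := (hM.integrable v).sub (hM.integrable u)
  have hc : P[M v - M u | 𝓕 u] =ᵐ[P] 0 := by
    refine (condExp_sub (hM.integrable v) (hM.integrable u) _).trans ?_
    have h1 := hM.condExp_ae_eq h
    have h2 := hM.condExp_ae_eq (le_refl u)
    filter_upwards [h1, h2] with ω a b
    simp [a, b]
  have hb := condExp_stronglyMeasurable_bilin_of_bound
    (ContinuousLinearMap.lsmul ℝ ℝ : ℝ →L[ℝ] ℂ →L[ℝ] ℂ).flip (𝓕.le u) hX hi 1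
    (Filter.Eventually.of_forall hX1)
  have h3 : ∫ ω, (P[fun ω ↦ (ContinuousLinearMap.lsmul ℝ ℝ : ℝ →L[ℝ] ℂ →L[ℝ] ℂ).flip (X ω)
      ((M v - M u) ω) | 𝓕 u]) ω ∂P = 0 := by
    rw [integral_congr_ae hb, integral_eq_zero_of_ae]
    filter_upwards [hc] with ω hω
    simp [hω]
  rw [integral_condExp] at h3
  rw [← h3]
  refine integral_congr_ae (Filter.Eventually.of_forall fun ω ↦ ?_)
  simp [mul_comm]

/-- Polarised quadratic variation: the product of the increments of two correlated Brownian
motions has conditional expectation `ρ (v - u)`. -/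
lemma integral_mul_increment_mul_increment [IsFiniteMeasure P] (h₁ : IsBrownianWrt W₁ 𝓕 P)
    (h₂ : IsBrownianWrt W₂ 𝓕 P) (hρ : IsAngleBracket W₂ W₁ (fun t _ ↦ ρ * (t : ℝ)) 𝓕 P)
    (h : u ≤ v) {X : Ω → ℂ} (hX : StronglyMeasurable[𝓕 u] X) (hX1 : ∀ ω, ‖X ω‖ ≤ 1) :
    ∫ ω, X ω * (((W₁ v ω - W₁ u ω) * (W₂ v ω - W₂ u ω) : ℝ) : ℂ) ∂P =
      (ρ * (v - u) : ℝ) * ∫ ω, X ω ∂P := by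
  have hb : ∀ {f : Ω → ℝ}, Integrable f P → Integrable (fun ω ↦ X ω * (f ω : ℂ)) P := fun hf ↦
    hf.ofReal.bdd_mul (hX.mono (𝓕.le u)).aestronglyMeasurable (Filter.Eventually.of_forall hX1)
  have p : Integrable (fun ω ↦ W₁ u ω * (W₂ v ω - W₂ u ω)) P :=
    (h₁.memLp_eval u (p := 2) (by simp)).integrable_mul (h₂.memLp_increment h (p := 2) (by simp))
  have q : Integrable (fun ω ↦ W₂ u ω * (W₁ v ω - W₁ u ω)) P :=
    (h₂.memLp_eval u (p := 2) (by simp)).integrable_mul (h₁.memLp_increment h (p := 2) (by simp))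
  have m := hρ.martingale.integral_mul_increment_eq_zero h hX hX1
  have im : Integrable (fun ω ↦ (W₂ v ω * W₁ v ω - ρ * v) - (W₂ u ω * W₁ u ω - ρ * u)) P :=
    (hρ.martingale.integrable v).sub (hρ.martingale.integrable u)
  have z1 : ∫ ω, X ω * ((W₁ u ω * (W₂ v ω - W₂ u ω) : ℝ) : ℂ) ∂P = 0 := by
    have := h₂.integral_mul_increment_eq_zero h (X := fun ω ↦ X ω * (W₁ u ω : ℂ))
      (hX.mul (Complex.continuous_ofReal.comp_stronglyMeasurable (h₁.adapted u)))
    rw [← this]; congr with ω; push_cast; ring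
  have z2 : ∫ ω, X ω * ((W₂ u ω * (W₁ v ω - W₁ u ω) : ℝ) : ℂ) ∂P = 0 := by
    have := h₁.integral_mul_increment_eq_zero h (X := fun ω ↦ X ω * (W₂ u ω : ℂ))
      (hX.mul (Complex.continuous_ofReal.comp_stronglyMeasurable (h₂.adapted u)))
    rw [← this]; congr with ω; push_cast; ring
  have e : ∀ ω, X ω * (((W₁ v ω - W₁ u ω) * (W₂ v ω - W₂ u ω) : ℝ) : ℂ) =
      X ω * (((W₂ v ω * W₁ v ω - ρ * v) - (W₂ u ω * W₁ u ω - ρ * u) : ℝ) : ℂ) -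
      X ω * ((W₁ u ω * (W₂ v ω - W₂ u ω) : ℝ) : ℂ) -
      X ω * ((W₂ u ω * (W₁ v ω - W₁ u ω) : ℝ) : ℂ) + (ρ * (v - u) : ℝ) * X ω := by
    intro ω; push_cast; ring
  have iX : Integrable X P := by simpa using hb (integrable_const (1 : ℝ))
  simp_rw [e]
  have j1 : Integrable (fun ω ↦
      X ω * (((W₂ v ω * W₁ v ω - ρ * v) - (W₂ u ω * W₁ u ω - ρ * u) : ℝ) : ℂ) -
      X ω * ((W₁ u ω * (W₂ v ω - W₂ u ω) : ℝ) : ℂ)) P := (hb im).sub (hb p)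
  have j2 : Integrable (fun ω ↦
      X ω * (((W₂ v ω * W₁ v ω - ρ * v) - (W₂ u ω * W₁ u ω - ρ * u) : ℝ) : ℂ) -
      X ω * ((W₁ u ω * (W₂ v ω - W₂ u ω) : ℝ) : ℂ) -
      X ω * ((W₂ u ω * (W₁ v ω - W₁ u ω) : ℝ) : ℂ)) P := j1.sub (hb q)
  rw [integral_add j2 (iX.const_mul _), integral_sub j1 (hb q), integral_sub (hb im) (hb p),
    integral_const_mul, z1, z2, m]
  simp

end Increments

/-! ### Characteristic functions along a partition -/

/-- The variance rate `a² + 2ρab + b²` of `a W₁ + b W₂` for two standard Brownian motions of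
correlation `ρ`. -/
noncomputable def varianceRate (ρ a b : ℝ) : ℝ := a ^ 2 + 2 * ρ * a * b + b ^ 2

section Lindeberg

variable {Ω : Type*} {mΩ : MeasurableSpace Ω} {P : Measure Ω}
  {𝓕 : Filtration ℝ≥0 mΩ} {W₁ W₂ : ℝ≥0 → Ω → ℝ} {ρ : ℝ} {u v : ℝ≥0}

lemma integral_mul_linear_increment_sq [IsProbabilityMeasure P]
    (h₁ : IsBrownianWrt W₁ 𝓕 P)
    (h₂ : IsBrownianWrt W₂ 𝓕 P) (hρ : IsAngleBracket W₂ W₁ (fun t _ ↦ ρ * (t : ℝ)) 𝓕 P)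
    (h : u ≤ v) {X : Ω → ℂ} (hX : StronglyMeasurable[𝓕 u] X) (hX1 : ∀ ω, ‖X ω‖ ≤ 1) (a b : ℝ) :
    ∫ ω, X ω * ((a * (W₁ v ω - W₁ u ω) + b * (W₂ v ω - W₂ u ω) : ℝ) : ℂ) ^ 2 ∂P =
      (varianceRate ρ a b * (v - u) : ℝ) * ∫ ω, X ω ∂P := by
  have hb : ∀ {f : Ω → ℝ}, Integrable f P → Integrable (fun ω ↦ X ω * (f ω : ℂ)) P := fun hf ↦
    hf.ofReal.bdd_mul (hX.mono (𝓕.le u)).aestronglyMeasurable (Filter.Eventually.of_forall hX1)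
  have m₁ := h₁.memLp_increment h (p := 2) (by simp)
  have m₂ := h₂.memLp_increment h (p := 2) (by simp)
  have i1 := (hb m₁.integrable_sq).const_mul ((a ^ 2 : ℝ) : ℂ)
  have i2 := (hb (m₁.integrable_mul m₂)).const_mul ((2 * a * b : ℝ) : ℂ)
  have i3 := (hb m₂.integrable_sq).const_mul ((b ^ 2 : ℝ) : ℂ)
  simp only [Pi.mul_apply] at i2
  have e : ∀ ω, X ω * ((a * (W₁ v ω - W₁ u ω) + b * (W₂ v ω - W₂ u ω) : ℝ) : ℂ) ^ 2 =
      ((a ^ 2 : ℝ) : ℂ) * (X ω * (((W₁ v ω - W₁ u ω) ^ 2 : ℝ) : ℂ)) +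
      ((2 * a * b : ℝ) : ℂ) * (X ω * (((W₁ v ω - W₁ u ω) * (W₂ v ω - W₂ u ω) : ℝ) : ℂ)) +
      ((b ^ 2 : ℝ) : ℂ) * (X ω * (((W₂ v ω - W₂ u ω) ^ 2 : ℝ) : ℂ)) := by
    intro ω; push_cast; ring
  have s1 := h₁.integral_mul_increment_sq h hX
  have s2 := h₂.integral_mul_increment_sq h hX
  simp_rw [← Complex.ofReal_pow] at s1 s2
  have i12 : Integrable (fun ω ↦
      ((a ^ 2 : ℝ) : ℂ) * (X ω * (((W₁ v ω - W₁ u ω) ^ 2 : ℝ) : ℂ)) +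
      ((2 * a * b : ℝ) : ℂ) * (X ω * (((W₁ v ω - W₁ u ω) * (W₂ v ω - W₂ u ω) : ℝ) : ℂ))) P :=
    i1.add i2
  simp_rw [e]
  rw [integral_add i12 i3, integral_add i1 i2, integral_const_mul,
    integral_const_mul, integral_const_mul, s1, s2,
    integral_mul_increment_mul_increment h₁ h₂ hρ h hX hX1, varianceRate]
  push_cast
  ring

lemma varianceRate_nonneg [IsProbabilityMeasure P]
    (h₁ : IsBrownianWrt W₁ 𝓕 P)
    (h₂ : IsBrownianWrt W₂ 𝓕 P) (hρ : IsAngleBracket W₂ W₁ (fun t _ ↦ ρ * (t : ℝ)) 𝓕 P)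
    (a b : ℝ) : 0 ≤ varianceRate ρ a b := by
  have h := integral_mul_linear_increment_sq h₁ h₂ hρ (zero_le_one (α := ℝ≥0))
    (X := fun _ ↦ 1) stronglyMeasurable_const (by simp) a b
  simp only [one_mul, ← Complex.ofReal_pow, integral_complex_ofReal, integral_const] at h
  have h' : ∫ ω, (a * (W₁ 1 ω - W₁ 0 ω) + b * (W₂ 1 ω - W₂ 0 ω)) ^ 2 ∂P = varianceRate ρ a b := by
    have := congrArg Complex.re h
    simpa using this
  rw [← h']
  positivity

lemma abs_linear_pow_three_le {a b x y A : ℝ} (ha : |a| ≤ A) (hb : |b| ≤ A) :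
    |a * x + b * y| ^ 3 ≤ 4 * A ^ 3 * (|x| ^ 3 + |y| ^ 3) := by
  have hA : 0 ≤ A := (abs_nonneg a).trans ha
  have h1 : |a * x + b * y| ≤ A * (|x| + |y|) := by
    calc _ ≤ |a| * |x| + |b| * |y| := by
          rw [← abs_mul, ← abs_mul]; exact abs_add_le _ _
      _ ≤ A * |x| + A * |y| := by gcongr
      _ = _ := by ring
  have h2 : (|x| + |y|) ^ 3 ≤ 4 * (|x| ^ 3 + |y| ^ 3) := by
    nlinarith [mul_nonneg (add_nonneg (abs_nonneg x) (abs_nonneg y)) (sq_nonneg (|x| - |y|))]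
  calc _ ≤ (A * (|x| + |y|)) ^ 3 := by gcongr
    _ = A ^ 3 * (|x| + |y|) ^ 3 := by ring
    _ ≤ A ^ 3 * (4 * (|x| ^ 3 + |y| ^ 3)) := by gcongr
    _ = _ := by ring

lemma integral_abs_linear_increment_pow_three_le (h₁ : IsBrownianWrt W₁ 𝓕 P)
    (h₂ : IsBrownianWrt W₂ 𝓕 P) (h : u ≤ v) {a b A : ℝ} (ha : |a| ≤ A) (hb : |b| ≤ A) :
    ∫ ω, |a * (W₁ v ω - W₁ u ω) + b * (W₂ v ω - W₂ u ω)| ^ 3 ∂P ≤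
      8 * A ^ 3 * (∫ x, |x| ^ 3 ∂(gaussianReal 0 1)) * √(v - u) ^ 3 := by
  have i₁ : Integrable (fun ω ↦ |W₁ v ω - W₁ u ω| ^ 3) P := by
    simpa using (h₁.memLp_increment h (p := 3) (by simp)).integrable_norm_pow (p := 3) (by norm_num)
  have i₂ : Integrable (fun ω ↦ |W₂ v ω - W₂ u ω| ^ 3) P := by
    simpa using (h₂.memLp_increment h (p := 3) (by simp)).integrable_norm_pow (p := 3) (by norm_num)
  calc _ ≤ ∫ ω, 4 * A ^ 3 * (|W₁ v ω - W₁ u ω| ^ 3 + |W₂ v ω - W₂ u ω| ^ 3) ∂P :=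
        integral_mono_of_nonneg (Filter.Eventually.of_forall fun ω ↦ by positivity)
          ((i₁.add i₂).const_mul _)
          (Filter.Eventually.of_forall fun ω ↦ abs_linear_pow_three_le ha hb)
    _ = _ := by
        rw [integral_const_mul, integral_add i₁ i₂, h₁.integral_increment_abs_pow_three h,
          h₂.integral_increment_abs_pow_three h]
        ring

/-- Over a short interval, the characteristic function of `a dW₁ + b dW₂`, weighted by the past, is
Gaussian up to an error of order `3/2` in the length, uniformly in bounded `a` and `b`. -/
lemma exists_norm_integral_mul_cexp_increment_sub_le [IsProbabilityMeasure P]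
    (h₁ : IsBrownianWrt W₁ 𝓕 P)
    (h₂ : IsBrownianWrt W₂ 𝓕 P) (hρ : IsAngleBracket W₂ W₁ (fun t _ ↦ ρ * (t : ℝ)) 𝓕 P) (A : ℝ) :
    ∃ K : ℝ, ∀ {u v : ℝ≥0} {a b : ℝ} {G : Ω → ℂ}, u ≤ v → |a| ≤ A → |b| ≤ A →
      StronglyMeasurable[𝓕 u] G → (∀ ω, ‖G ω‖ ≤ 1) →
      ‖∫ ω, G ω * Complex.exp
          ((a * (W₁ v ω - W₁ u ω) + b * (W₂ v ω - W₂ u ω) : ℝ) * Complex.I) ∂P -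
        Real.exp (-(varianceRate ρ a b * (v - u) / 2)) * ∫ ω, G ω ∂P‖
      ≤ K * (√(v - u) ^ 3 + ((v : ℝ) - u) ^ 2) := by
  set K₁ := 4 * (8 * A ^ 3 * ∫ x, |x| ^ 3 ∂(gaussianReal 0 1))
  set K₂ := ((1 + |ρ|) * A ^ 2) ^ 2
  refine ⟨max K₁ K₂, fun {u v a b G} h ha hb hG hG1 ↦ ?_⟩
  have hδ : 0 ≤ (v : ℝ) - u := sub_nonneg.2 (NNReal.coe_le_coe.2 h)
  have hA : 0 ≤ A := (abs_nonneg a).trans ha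
  have hr := varianceRate_nonneg h₁ h₂ hρ a b
  have hbd {f : Ω → ℝ} (hf : Integrable f P) : Integrable (fun ω ↦ G ω * (f ω : ℂ)) P :=
    hf.ofReal.bdd_mul (hG.mono (𝓕.le u)).aestronglyMeasurable (Filter.Eventually.of_forall hG1)
  have m₁ := h₁.memLp_increment h (p := 3) (by simp)
  have m₂ := h₂.memLp_increment h (p := 3) (by simp)
  have hmean : ∫ ω, G ω * ((a * (W₁ v ω - W₁ u ω) + b * (W₂ v ω - W₂ u ω) : ℝ) : ℂ) ∂P = 0 := by
    have e : ∀ ω, G ω * ((a * (W₁ v ω - W₁ u ω) + b * (W₂ v ω - W₂ u ω) : ℝ) : ℂ) =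
        a * (G ω * ((W₁ v ω - W₁ u ω : ℝ) : ℂ)) + b * (G ω * ((W₂ v ω - W₂ u ω : ℝ) : ℂ)) := by
      intro ω; push_cast; ring
    simp_rw [e]
    rw [integral_add ((hbd (m₁.integrable (by norm_num))).const_mul _)
      ((hbd (m₂.integrable (by norm_num))).const_mul _), integral_const_mul, integral_const_mul,
      h₁.integral_mul_increment_eq_zero h hG, h₂.integral_mul_increment_eq_zero h hG]
    simp
  have hle : varianceRate ρ a b ≤ 2 * ((1 + |ρ|) * A ^ 2) := by
    have h1 : a ^ 2 ≤ A ^ 2 := sq_le_sq' (by linarith [neg_abs_le a]) ((le_abs_self a).trans ha)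
    have h2 : b ^ 2 ≤ A ^ 2 := sq_le_sq' (by linarith [neg_abs_le b]) ((le_abs_self b).trans hb)
    have h3 : ρ * a * b ≤ |ρ| * (A * A) := by
      calc ρ * a * b ≤ |ρ * a * b| := le_abs_self _
        _ = |ρ| * (|a| * |b|) := by rw [abs_mul, abs_mul, mul_assoc]
        _ ≤ _ := by gcongr
    unfold varianceRate
    nlinarith
  refine (norm_integral_mul_cexp_sub_le (hG.mono (𝓕.le u)).aestronglyMeasurable hG1
    ((m₁.const_mul a).add (m₂.const_mul b)) (mul_nonneg hr hδ) hmean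
    (integral_mul_linear_increment_sq h₁ h₂ hρ h hG hG1 a b)
    (integral_abs_linear_increment_pow_three_le h₁ h₂ h ha hb)).trans ?_
  calc _ ≤ K₁ * √(v - u) ^ 3 + K₂ * ((v : ℝ) - u) ^ 2 := by
        refine add_le_add (le_of_eq (by simp only [K₁]; ring)) ?_
        calc (varianceRate ρ a b * ((v : ℝ) - u) / 2) ^ 2
            ≤ (2 * ((1 + |ρ|) * A ^ 2) * ((v : ℝ) - u) / 2) ^ 2 := by gcongr
          _ = _ := by simp only [K₂]; ring
    _ ≤ max K₁ K₂ * √(v - u) ^ 3 + max K₁ K₂ * ((v : ℝ) - u) ^ 2 := by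
        gcongr
        · exact le_max_left _ _
        · exact le_max_right _ _
    _ = _ := by ring

/-- Lindeberg's telescoping: one-step errors along a uniform partition add up. -/
lemma exists_norm_integral_mul_cexp_sum_sub_le [IsProbabilityMeasure P]
    (h₁ : IsBrownianWrt W₁ 𝓕 P)
    (h₂ : IsBrownianWrt W₂ 𝓕 P) (hρ : IsAngleBracket W₂ W₁ (fun t _ ↦ ρ * (t : ℝ)) 𝓕 P) (A : ℝ) :
    ∃ K : ℝ, ∀ {t : ℝ≥0} {b : ℝ} {G : Ω → ℂ} (δ : ℝ≥0) (a : ℕ → ℝ) (n : ℕ),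
      (∀ k < n, |a k| ≤ A) → |b| ≤ A →
      StronglyMeasurable[𝓕 t] G → (∀ ω, ‖G ω‖ ≤ 1) →
      ‖∫ ω, G ω * Complex.exp ((∑ k ∈ Finset.range n,
          (a k * (W₁ (t + (k + 1) * δ) ω - W₁ (t + k * δ) ω) +
            b * (W₂ (t + (k + 1) * δ) ω - W₂ (t + k * δ) ω)) : ℝ) * Complex.I) ∂P -
        Real.exp (-((∑ k ∈ Finset.range n, varianceRate ρ (a k) b * δ) / 2)) * ∫ ω, G ω ∂P‖
      ≤ n * (K * (√δ ^ 3 + (δ : ℝ) ^ 2)) := by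
  obtain ⟨K, hK⟩ := exists_norm_integral_mul_cexp_increment_sub_le h₁ h₂ hρ A
  refine ⟨K, fun {t b G} δ a n ha hb hG hG1 ↦ ?_⟩
  induction n with
  | zero => simp
  | succ n ih =>
    specialize ih fun k hk ↦ ha k (by omega)
    set ξ : ℕ → Ω → ℝ := fun k ω ↦ a k * (W₁ (t + (k + 1) * δ) ω - W₁ (t + k * δ) ω) +
            b * (W₂ (t + (k + 1) * δ) ω - W₂ (t + k * δ) ω) with hξ
    have hle : t + n * δ ≤ t + (n + 1) * δ := by gcongr; simp
    have hmeas (i : ℝ≥0) (hi : i ≤ t + n * δ) :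
        StronglyMeasurable[𝓕 (t + n * δ)] (W₁ i) ∧ StronglyMeasurable[𝓕 (t + n * δ)] (W₂ i) :=
      ⟨(h₁.adapted i).mono (𝓕.mono hi), (h₂.adapted i).mono (𝓕.mono hi)⟩
    have hS : StronglyMeasurable[𝓕 (t + n * δ)] (fun ω ↦ ∑ k ∈ Finset.range n, ξ k ω) := by
      refine Finset.stronglyMeasurable_fun_sum _ fun k hk ↦ ?_
      have hk' : ((k : ℝ≥0) + 1) ≤ n := by exact_mod_cast Finset.mem_range.1 hk
      have l1 : t + (k + 1) * δ ≤ t + n * δ := by gcongr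
      have l2 : t + k * δ ≤ t + n * δ := le_trans (by gcongr; simp) l1
      exact (((hmeas _ l1).1.sub (hmeas _ l2).1).const_mul _).add
        (((hmeas _ l1).2.sub (hmeas _ l2).2).const_mul _)
    set G' : Ω → ℂ := fun ω ↦ G ω * Complex.exp ((∑ k ∈ Finset.range n, ξ k ω : ℝ) * Complex.I)
      with hG'
    have hG'm : StronglyMeasurable[𝓕 (t + n * δ)] G' :=
      (hG.mono (𝓕.mono (by simp))).mul
        ((by fun_prop : Continuous fun x : ℝ ↦ Complex.exp (x * Complex.I)).comp_stronglyMeasurable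
          hS)
    have hG'1 : ∀ ω, ‖G' ω‖ ≤ 1 := fun ω ↦ by
      simp only [hG', norm_mul, Complex.norm_exp_ofReal_mul_I, mul_one]
      exact hG1 ω
    have step := hK hle (ha n (by omega)) hb hG'm hG'1
    have hδ : ((t + (n + 1) * δ : ℝ≥0) : ℝ) - (t + n * δ : ℝ≥0) = δ := by push_cast; ring
    rw [hδ] at step
    have e1 : ∀ ω, G ω * Complex.exp ((∑ k ∈ Finset.range (n + 1), ξ k ω : ℝ) * Complex.I) =
        G' ω * Complex.exp ((ξ n ω : ℝ) * Complex.I) := fun ω ↦ by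
      rw [hG', Finset.sum_range_succ, mul_assoc, ← Complex.exp_add]
      push_cast; ring_nf
    have e2 : ((Real.exp (-((∑ k ∈ Finset.range (n + 1), varianceRate ρ (a k) b * δ) / 2)) : ℝ) : ℂ)
        = (Real.exp (-(varianceRate ρ (a n) b * δ / 2)) : ℝ) *
          (Real.exp (-((∑ k ∈ Finset.range n, varianceRate ρ (a k) b * δ) / 2)) : ℝ) := by
      rw [Finset.sum_range_succ, ← Complex.ofReal_mul, ← Real.exp_add]
      congr 2
      ring
    change ‖∫ ω, G ω * Complex.exp ((∑ k ∈ Finset.range (n + 1), ξ k ω : ℝ) * Complex.I) ∂P - _‖ ≤ _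
    simp_rw [e1]
    rw [e2]
    set E : ℂ := ((Real.exp (-(varianceRate ρ (a n) b * δ / 2)) : ℝ) : ℂ)
    have hE : ‖E‖ ≤ 1 := by
      rw [Complex.norm_real, Real.norm_eq_abs, Real.abs_exp, Real.exp_le_one_iff]
      have := mul_nonneg (varianceRate_nonneg h₁ h₂ hρ (a n) b) δ.coe_nonneg
      linarith
    set F : ℂ :=
      ((Real.exp (-((∑ k ∈ Finset.range n, varianceRate ρ (a k) b * δ) / 2)) : ℝ) : ℂ)
    calc _ = ‖(∫ ω, G' ω * Complex.exp ((ξ n ω : ℝ) * Complex.I) ∂P - E * ∫ ω, G' ω ∂P) +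
          E * (∫ ω, G' ω ∂P - F * ∫ ω, G ω ∂P)‖ := by congr 1; ring
      _ ≤ K * (√δ ^ 3 + (δ : ℝ) ^ 2) + n * (K * (√δ ^ 3 + (δ : ℝ) ^ 2)) := by
          refine (norm_add_le _ _).trans (add_le_add step ?_)
          rw [norm_mul]
          exact (mul_le_of_le_one_left (norm_nonneg _) hE).trans ih
      _ = _ := by push_cast; ring

end Lindeberg

open Filter Topology

/-! ### Convergence of Riemann sums -/

/-- Riemann sums for `∫ h g` in which only `h` is discretised; `ε ∈ [0, 1]` places the evaluation
point in each cell of the uniform partition. -/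
lemma tendsto_sum_mul_intervalIntegral {g h : ℝ → ℝ} (hg : Continuous g) (hh : Continuous h)
    {T ε : ℝ} (hT : 0 ≤ T) (hε : ε ∈ Set.Icc (0 : ℝ) 1) :
    Tendsto (fun n : ℕ ↦ ∑ k ∈ Finset.range n,
      h ((k + ε) * (T / n)) * ∫ s in (k * (T / n))..((k + 1) * (T / n)), g s) atTop
      (𝓝 (∫ s in (0 : ℝ)..T, h s * g s)) := by
  obtain ⟨C, hC⟩ := isCompact_Icc.exists_bound_of_continuousOn (s := Set.Icc 0 T) hg.continuousOn
  have hC0 : 0 ≤ C := (norm_nonneg _).trans (hC 0 ⟨le_rfl, hT⟩)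
  have huc := isCompact_Icc.uniformContinuousOn_of_continuous (s := Set.Icc 0 T) hh.continuousOn
  rw [Metric.tendsto_atTop]
  intro η hη
  set η' := η / (C * T + 1) with hη'
  have hCT : 0 < C * T + 1 := by positivity
  have hη'0 : 0 < η' := by positivity
  obtain ⟨d, hd, hd'⟩ := Metric.uniformContinuousOn_iff.1 huc η' hη'0
  obtain ⟨N, hN⟩ := exists_nat_gt (T / d)
  refine ⟨N + 1, fun n hn ↦ ?_⟩
  have hn0 : (0 : ℝ) < n := by exact_mod_cast (by omega : 0 < n)
  have hδ : T / n < d := by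
    rw [div_lt_iff₀ hn0]
    rw [div_lt_iff₀ hd] at hN
    have : (N : ℝ) ≤ n := by exact_mod_cast (by omega : N ≤ n)
    nlinarith
  have hδ0 : 0 ≤ T / n := by positivity
  -- each cell contributes at most `η' * C * (T / n)`, by uniform continuity of `h`
  have hsplit : ∫ s in (0 : ℝ)..T, h s * g s = ∑ k ∈ Finset.range n,
      ∫ s in (k * (T / n))..((k + 1) * (T / n)), h s * g s := by
    have := intervalIntegral.sum_integral_adjacent_intervals (μ := volume)
      (f := fun s ↦ h s * g s) (a := fun k : ℕ ↦ (k : ℝ) * (T / n)) (n := n)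
      fun k _ ↦ (hh.mul hg).intervalIntegrable _ _
    push_cast at this
    rw [this, zero_mul, mul_div_cancel₀ _ hn0.ne']
  rw [dist_eq_norm, hsplit, ← Finset.sum_sub_distrib]
  have hterm : ∀ k ∈ Finset.range n,
      ‖h ((k + ε) * (T / n)) * (∫ s in (k * (T / n))..((k + 1) * (T / n)), g s) -
        ∫ s in (k * (T / n))..((k + 1) * (T / n)), h s * g s‖ ≤ η' * C * (T / n) := by
    intro k hk
    have hk1 : (k : ℝ) + 1 ≤ n := by exact_mod_cast Finset.mem_range.1 hk
    have hk0 : (0 : ℝ) ≤ k := k.cast_nonneg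
    have hTn : n * (T / n) = T := mul_div_cancel₀ _ hn0.ne'
    have hmem : ∀ x, k * (T / n) ≤ x → x ≤ (k + 1) * (T / n) → x ∈ Set.Icc 0 T := fun x h1 h2 ↦
      ⟨(mul_nonneg hk0 hδ0).trans h1, h2.trans ((mul_le_mul_of_nonneg_right hk1 hδ0).trans_eq hTn)⟩
    have hi₁ : IntervalIntegrable (fun s ↦ h ((k + ε) * (T / n)) * g s) volume
        (k * (T / n)) ((k + 1) * (T / n)) := (continuous_const.mul hg).intervalIntegrable _ _
    have hi₂ : IntervalIntegrable (fun s ↦ h s * g s) volume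
        (k * (T / n)) ((k + 1) * (T / n)) := (hh.mul hg).intervalIntegrable _ _
    rw [← intervalIntegral.integral_const_mul, ← intervalIntegral.integral_sub hi₁ hi₂]
    refine (intervalIntegral.norm_integral_le_of_norm_le_const (C := η' * C) fun s hs ↦ ?_).trans ?_
    · rw [Set.uIoc_of_le (by nlinarith)] at hs
      have hs' := hmem s hs.1.le hs.2
      have e1 : k * (T / n) ≤ (k + ε) * (T / n) := by gcongr; linarith [hε.1]
      have e2 : (k + ε) * (T / n) ≤ (k + 1) * (T / n) := by gcongr; exact hε.2
      rw [← sub_mul, norm_mul]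
      refine mul_le_mul ?_ (hC s hs') (norm_nonneg _) hη'0.le
      rw [← dist_eq_norm]
      refine (hd' _ (hmem _ e1 e2) _ hs' ?_).le
      rw [Real.dist_eq, abs_lt]
      constructor <;> nlinarith [hs.1, hs.2]
    · have : (k + 1) * (T / n) - k * (T / n) = T / n := by ring
      rw [this, abs_of_nonneg hδ0]
  refine (norm_sum_le _ _).trans_lt ((Finset.sum_le_sum hterm).trans_lt ?_)
  rw [Finset.sum_const, Finset.card_range, nsmul_eq_mul]
  calc (n : ℝ) * (η' * C * (T / n)) = η' * (C * T) := by field_simp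
    _ < η' * (C * T + 1) := by gcongr; linarith
    _ = η := by rw [hη']; field_simp

/-- For `f` continuously differentiable and `B` merely continuous with `B 0 = 0`, the left
Riemann–Stieltjes sums `∑ f ΔB` converge to the value that integration by parts assigns to
`∫ f dB`. -/
lemma tendsto_sum_mul_sub {f g B : ℝ → ℝ} (hf : ∀ s, HasDerivAt f (g s) s) (hg : Continuous g)
    (hB : Continuous B) (hB0 : B 0 = 0) {T : ℝ} (hT : 0 ≤ T) :
    Tendsto (fun n : ℕ ↦ ∑ k ∈ Finset.range n,
      f (k * (T / n)) * (B ((k + 1) * (T / n)) - B (k * (T / n)))) atTop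
      (𝓝 (f T * B T - ∫ s in (0 : ℝ)..T, B s * g s)) := by
  have h1 := (tendsto_sum_mul_intervalIntegral hg hB hT (ε := 1) (by simp)).const_sub (f T * B T)
  refine h1.congr' ?_
  filter_upwards [eventually_gt_atTop 0] with n hn
  have hn0 : (n : ℝ) ≠ 0 := by positivity
  have habel : ∀ m : ℕ, ∑ k ∈ Finset.range m,
      f (k * (T / n)) * (B ((k + 1) * (T / n)) - B (k * (T / n))) =
      f (m * (T / n)) * B (m * (T / n)) - ∑ k ∈ Finset.range m,
        B ((k + 1) * (T / n)) * ∫ s in (k * (T / n))..((k + 1) * (T / n)), g s := by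
    intro m
    induction m with
    | zero => simp [hB0]
    | succ m ih =>
      rw [Finset.sum_range_succ, Finset.sum_range_succ, ih,
        intervalIntegral.integral_eq_sub_of_hasDerivAt (fun s _ ↦ hf s) (hg.intervalIntegrable _ _)]
      push_cast
      ring
  rw [habel n, mul_div_cancel₀ _ hn0]

/-! ### Wiener integrals of deterministic weights -/

section WienerIntegral

variable {Ω : Type*} {mΩ : MeasurableSpace Ω} {P : Measure Ω} [IsProbabilityMeasure P]
  {𝓕 : Filtration ℝ≥0 mΩ} {W₁ W₂ : ℝ≥0 → Ω → ℝ} {ρ : ℝ}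

/-- Characteristic function of the Wiener integral `∫ f dW₁ + b ∫ dW₂` over `[t, t + T]`, weighted
by the past. The integral against `W₁` is written in its integrated-by-parts, pathwise form. -/
lemma integral_mul_cexp_wienerIntegral (h₁ : IsBrownianWrt W₁ 𝓕 P)
    (h₂ : IsBrownianWrt W₂ 𝓕 P) (hρ : IsAngleBracket W₂ W₁ (fun t _ ↦ ρ * (t : ℝ)) 𝓕 P)
    {f g : ℝ → ℝ} (hf : ∀ s, HasDerivAt f (g s) s) (hg : Continuous g) (b : ℝ) (t T : ℝ≥0)
    {G : Ω → ℂ} (hG : StronglyMeasurable[𝓕 t] G) (hG1 : ∀ ω, ‖G ω‖ ≤ 1) :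
    ∫ ω, G ω * Complex.exp ((f T * (W₁ (t + T) ω - W₁ t ω) -
        (∫ s in (0 : ℝ)..T, (W₁ (t + s.toNNReal) ω - W₁ t ω) * g s) +
        b * (W₂ (t + T) ω - W₂ t ω) : ℝ) * Complex.I) ∂P =
      Real.exp (-((∫ s in (0 : ℝ)..T, varianceRate ρ (f s) b) / 2)) * ∫ ω, G ω ∂P := by
  have hfc : Continuous f := continuous_iff_continuousAt.2 fun s ↦ (hf s).continuousAt
  obtain ⟨A₀, hA₀⟩ := isCompact_Icc.exists_bound_of_continuousOn (s := Set.Icc 0 (T : ℝ))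
    hfc.continuousOn
  obtain ⟨K, hK⟩ := exists_norm_integral_mul_cexp_sum_sub_le h₁ h₂ hρ (max A₀ |b|)
  have hK' (n : ℕ) (hn : 0 < n) := hK (b := b) (T / n) (fun k ↦ f (k * (T / n))) n
    (fun k hk ↦ (hA₀ _ ⟨by positivity, by
      have : (0 : ℝ) < n := by exact_mod_cast hn
      calc (k : ℝ) * (T / n) ≤ n * (T / n) := by gcongr
        _ = T := mul_div_cancel₀ _ this.ne'⟩).trans (le_max_left _ _)) (le_max_right _ _) hG hG1
  set S : ℕ → Ω → ℝ := fun n ω ↦ ∑ k ∈ Finset.range n,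
          (f (k * (T / n)) * (W₁ (t + (k + 1) * (T / n)) ω - W₁ (t + k * (T / n)) ω) +
            b * (W₂ (t + (k + 1) * (T / n)) ω - W₂ (t + k * (T / n)) ω)) with hS
  -- the discretised Wiener integrals converge path by path
  have hlim : ∀ᵐ ω ∂P, Tendsto (fun n ↦ S n ω) atTop
      (𝓝 (f T * (W₁ (t + T) ω - W₁ t ω) -
        (∫ s in (0 : ℝ)..T, (W₁ (t + s.toNNReal) ω - W₁ t ω) * g s) +
        b * (W₂ (t + T) ω - W₂ t ω))) := by
    filter_upwards [h₁.isBrownian.cont] with ω hω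
    have hB : Continuous fun s : ℝ ↦ W₁ (t + s.toNNReal) ω - W₁ t ω :=
      (hω.comp (continuous_const.add continuous_real_toNNReal)).sub continuous_const
    have h3 := (tendsto_sum_mul_sub hf hg hB (by simp) T.2).add_const (b * (W₂ (t + T) ω - W₂ t ω))
    simp only [NNReal.val_eq_coe, Real.toNNReal_coe] at h3
    refine h3.congr' ?_
    filter_upwards [eventually_gt_atTop 0] with n hn
    have hn0 : (n : ℝ≥0) ≠ 0 := by positivity
    have hcast (k : ℕ) : ((k : ℝ) * (T / n)).toNNReal = k * (T / n) := by
      rw [← Real.toNNReal_coe (r := k * (T / n))]; push_cast; rfl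
    have hcast' (k : ℕ) : (((k : ℝ) + 1) * (T / n)).toNNReal = (k + 1) * (T / n) := by
      rw [← Real.toNNReal_coe (r := (k + 1) * (T / n))]; push_cast; rfl
    -- `b` is constant, so the part driven by `W₂` telescopes exactly
    have htel : ∑ k ∈ Finset.range n,
        b * (W₂ (t + (k + 1) * (T / n)) ω - W₂ (t + k * (T / n)) ω) =
        b * (W₂ (t + T) ω - W₂ t ω) := by
      have := Finset.sum_range_sub (fun k : ℕ ↦ W₂ (t + k * (T / n)) ω) n
      push_cast at this
      rw [← Finset.mul_sum, this, mul_div_cancel₀ _ hn0]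
      simp
    simp only [hS, Finset.sum_add_distrib, htel, hcast, hcast', sub_sub_sub_cancel_right]
  have hm₁ (i : ℝ≥0) : Measurable (W₁ i) := ((h₁.adapted i).mono (𝓕.le i)).measurable
  have hm₂ (i : ℝ≥0) : Measurable (W₂ i) := ((h₂.adapted i).mono (𝓕.le i)).measurable
  have hL : Tendsto (fun n ↦ ∫ ω, G ω * Complex.exp ((S n ω : ℝ) * Complex.I) ∂P) atTop
      (𝓝 (∫ ω, G ω * Complex.exp ((f T * (W₁ (t + T) ω - W₁ t ω) -
        (∫ s in (0 : ℝ)..T, (W₁ (t + s.toNNReal) ω - W₁ t ω) * g s) +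
        b * (W₂ (t + T) ω - W₂ t ω) : ℝ) * Complex.I) ∂P)) := by
    refine tendsto_integral_of_dominated_convergence (fun _ ↦ 1) (fun n ↦ ?_) (integrable_const _)
      (fun n ↦ Eventually.of_forall fun ω ↦ ?_) ?_
    · have hSm : Measurable (S n) := by fun_prop
      exact (hG.mono (𝓕.le t)).aestronglyMeasurable.mul
        (by fun_prop : Measurable fun ω ↦ Complex.exp ((S n ω : ℝ) * Complex.I)).aestronglyMeasurable
    · rw [norm_mul, Complex.norm_exp_ofReal_mul_I, mul_one]
      exact hG1 ω
    · filter_upwards [hlim] with ω hω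
      exact (((by fun_prop : Continuous fun x : ℝ ↦ Complex.exp (x * Complex.I)).tendsto _).comp
        hω).const_mul _
  have hR : Tendsto (fun n : ℕ ↦ ((Real.exp (-((∑ k ∈ Finset.range n,
      varianceRate ρ (f (k * (T / n))) b * ((T / n : ℝ≥0) : ℝ)) / 2)) : ℝ) : ℂ) * ∫ ω, G ω ∂P) atTop
      (𝓝 (Real.exp (-((∫ s in (0 : ℝ)..T, varianceRate ρ (f s) b) / 2)) * ∫ ω, G ω ∂P)) := by
    have hv : Continuous fun s ↦ varianceRate ρ (f s) b := by unfold varianceRate; fun_prop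
    have h4 := tendsto_sum_mul_intervalIntegral (g := fun _ ↦ 1) continuous_const hv T.2 (ε := 0)
      (by simp)
    simp only [NNReal.val_eq_coe, add_zero, intervalIntegral.integral_const, smul_eq_mul, mul_one]
      at h4
    have h5 := (((by fun_prop : Continuous fun x : ℝ ↦ ((Real.exp (-(x / 2)) : ℝ) : ℂ)).tendsto
      _).comp h4).mul_const (∫ ω, G ω ∂P)
    refine h5.congr fun n ↦ ?_
    simp only [Function.comp_apply]
    congr 5
    refine Finset.sum_congr rfl fun k _ ↦ ?_
    push_cast
    ring
  -- `n` steps of error `O((T / n) ^ (3 / 2))` vanish in the limit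
  have hE : Tendsto (fun n : ℕ ↦ (n : ℝ) * (K * (√((T / n : ℝ≥0) : ℝ) ^ 3 +
      ((T / n : ℝ≥0) : ℝ) ^ 2))) atTop (𝓝 0) := by
    have h0 : Tendsto (fun n : ℕ ↦ (T : ℝ) / n) atTop (𝓝 0) := tendsto_const_div_atTop_nhds_zero_nat _
    have h6 : Tendsto (fun n : ℕ ↦ K * T * (√((T : ℝ) / n) + (T : ℝ) / n)) atTop
        (𝓝 (K * T * (√0 + 0))) :=
      ((((Real.continuous_sqrt.tendsto 0).comp h0).add h0).const_mul _)
    rw [Real.sqrt_zero, add_zero, mul_zero] at h6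
    refine h6.congr' ?_
    filter_upwards [eventually_gt_atTop 0] with n hn
    have hn0 : (n : ℝ) ≠ 0 := by positivity
    have hsq : √((T : ℝ) / n) ^ 3 = (T : ℝ) / n * √((T : ℝ) / n) := by
      rw [pow_succ, Real.sq_sqrt (by positivity)]
    push_cast
    rw [hsq]
    field_simp
  have hD := squeeze_zero_norm' (by
    filter_upwards [eventually_gt_atTop 0] with n hn using hK' n hn) hE
  exact sub_eq_zero.1 (tendsto_nhds_unique (hL.sub hR) hD)

end WienerIntegral

/-! ### Vasicek weights and the covariance matrix -/

/-- The coefficient against `dW^r` of the linear combination of the increments of `R` and `I` with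
weights `x` and `y`, at time `s` after the start of an interval of length `T`. -/
noncomputable def vasicekWeight (κ T x y s : ℝ) : ℝ :=
  x * Real.exp (-κ * (T - s)) + y * ((1 - Real.exp (-κ * (T - s))) / κ)

lemma hasDerivAt_exp_neg_mul_sub (κ T s : ℝ) :
    HasDerivAt (fun s ↦ Real.exp (-κ * (T - s))) (κ * Real.exp (-κ * (T - s))) s := by
  have h : HasDerivAt (fun s : ℝ ↦ -κ * (T - s)) κ s := by
    simpa using ((hasDerivAt_id s).const_sub T).const_mul (-κ)
  simpa [mul_comm] using h.exp

lemma hasDerivAt_vasicekWeight {κ : ℝ} (hκ : κ ≠ 0) (T x y s : ℝ) :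
    HasDerivAt (vasicekWeight κ T x y) ((κ * x - y) * Real.exp (-κ * (T - s))) s := by
  have h := hasDerivAt_exp_neg_mul_sub κ T s
  refine ((h.const_mul x).add (((h.const_sub 1).div_const κ).const_mul y)).congr_deriv ?_
  field_simp
  ring

lemma integral_exp_neg_mul_sub {κ : ℝ} (hκ : κ ≠ 0) (T : ℝ) :
    ∫ s in (0 : ℝ)..T, Real.exp (-κ * (T - s)) = (1 - Real.exp (-κ * T)) / κ := by
  have h : ∀ s, HasDerivAt (fun s ↦ Real.exp (-κ * (T - s)) / κ) (Real.exp (-κ * (T - s))) s := by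
    intro s
    refine ((hasDerivAt_exp_neg_mul_sub κ T s).div_const κ).congr_deriv ?_
    field_simp
  rw [intervalIntegral.integral_eq_sub_of_hasDerivAt (fun s _ ↦ h s)
    ((by fun_prop : Continuous fun s ↦ Real.exp (-κ * (T - s))).intervalIntegrable _ _)]
  simp [sub_div]

/-- Variation of constants: integrated form of the solution of `r' = -κ r + B'`, `r 0 = x`. -/
lemma integral_eq_of_linear_integral_equation {κ x T : ℝ} (hκ : κ ≠ 0) (hT : 0 ≤ T) {r B : ℝ → ℝ}
    (hr : Continuous r) (hB : Continuous B)
    (h : ∀ s ∈ Set.Icc 0 T, r s = x - κ * (∫ u in (0 : ℝ)..s, r u) + B s) :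
    ∫ s in (0 : ℝ)..T, r s =
      x * ((1 - Real.exp (-κ * T)) / κ) + ∫ s in (0 : ℝ)..T, B s * Real.exp (-κ * (T - s)) := by
  have hd : ∀ s ∈ Set.uIcc 0 T,
      HasDerivAt (fun s ↦ Real.exp (-κ * (T - s)) * ∫ u in (0 : ℝ)..s, r u)
        (x * Real.exp (-κ * (T - s)) + B s * Real.exp (-κ * (T - s))) s := by
    intro s hs
    rw [Set.uIcc_of_le hT] at hs
    refine ((hasDerivAt_exp_neg_mul_sub κ T s).mul
      (hr.integral_hasStrictDerivAt 0 s).hasDerivAt).congr_deriv ?_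
    rw [h s hs]
    ring
  have c₁ : IntervalIntegrable (fun s ↦ x * Real.exp (-κ * (T - s))) volume 0 T :=
    (by fun_prop : Continuous _).intervalIntegrable _ _
  have c₂ : IntervalIntegrable (fun s ↦ B s * Real.exp (-κ * (T - s))) volume 0 T :=
    (by fun_prop : Continuous _).intervalIntegrable _ _
  have := intervalIntegral.integral_eq_sub_of_hasDerivAt hd (c₁.add c₂)
  rw [intervalIntegral.integral_add c₁ c₂, intervalIntegral.integral_const_mul,
    integral_exp_neg_mul_sub hκ] at this
  simpa using this.symm

/-- The Itô isometry for the increments: the quadratic form of `condCov` is an integral of variance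
rates, which gives both its positivity and the variance of the limiting Gaussian. -/
lemma dotProduct_condCov_mulVec {κ : ℝ} (hκ : κ ≠ 0) (ρ T : ℝ) (θ : Fin 3 → ℝ) :
    θ ⬝ᵥ condCov κ ρ T *ᵥ θ =
      ∫ s in (0 : ℝ)..T, varianceRate ρ (vasicekWeight κ T (θ 0) (θ 1) s) (θ 2) := by
  -- with `E = exp (-κ (T - s))` the weight is `p + q E`, so the integrand is quadratic in `E`
  set p := θ 1 / κ
  set q := θ 0 - θ 1 / κ
  have hd : ∀ s, HasDerivAt (fun s ↦ (p ^ 2 + 2 * ρ * p * θ 2 + θ 2 ^ 2) * s +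
      (2 * p * q + 2 * ρ * q * θ 2) / κ * Real.exp (-κ * (T - s)) +
      q ^ 2 / (2 * κ) * Real.exp (-κ * (T - s)) ^ 2)
      (varianceRate ρ (vasicekWeight κ T (θ 0) (θ 1) s) (θ 2)) s := by
    intro s
    have h := hasDerivAt_exp_neg_mul_sub κ T s
    refine ((((hasDerivAt_id s).const_mul (p ^ 2 + 2 * ρ * p * θ 2 + θ 2 ^ 2)).add
      (h.const_mul ((2 * p * q + 2 * ρ * q * θ 2) / κ))).add
      ((h.pow 2).const_mul (q ^ 2 / (2 * κ)))).congr_deriv ?_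
    simp only [varianceRate, vasicekWeight, p, q]
    field_simp
    ring
  have hc : Continuous fun s ↦ varianceRate ρ (vasicekWeight κ T (θ 0) (θ 1) s) (θ 2) := by
    unfold varianceRate vasicekWeight; fun_prop
  rw [intervalIntegral.integral_eq_sub_of_hasDerivAt (fun s _ ↦ hd s) (hc.intervalIntegrable _ _)]
  have he : Real.exp (-2 * κ * T) = Real.exp (-κ * T) ^ 2 := by
    rw [← Real.exp_nat_mul]; congr 1; push_cast; ring
  simp only [dotProduct, Matrix.mulVec, Fin.sum_univ_three, condCov, he, sub_zero, sub_self,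
    mul_zero, Real.exp_zero, p, q]
  simp
  field_simp
  ring

/-! ### Gaussian conditional laws from characteristic functions -/

/-- `N` is independent of `X` with law `ν` as soon as weighting by the characters of `X` leaves the
characteristic function of `N` equal to that of `ν`. -/
lemma map_prodMk_eq_prod_of_integral_cexp {Ω E : Type*} {mΩ : MeasurableSpace Ω} {P : Measure Ω}
    [IsProbabilityMeasure P] [NormedAddCommGroup E] [InnerProductSpace ℝ E] [CompleteSpace E]
    [SecondCountableTopology E] [MeasurableSpace E] [BorelSpace E]
    {ν : Measure E} [IsProbabilityMeasure ν] {X : Ω → ℝ} {N : Ω → E}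
    (hX : AEMeasurable X P) (hN : AEMeasurable N P)
    (h : ∀ (x : ℝ) (θ : E), ∫ ω, Complex.exp ((x * X ω : ℝ) * Complex.I) *
        Complex.exp ((inner ℝ (N ω) θ : ℝ) * Complex.I) ∂P =
      charFun ν θ * ∫ ω, Complex.exp ((x * X ω : ℝ) * Complex.I) ∂P) :
    P.map (fun ω ↦ (X ω, N ω)) = (P.map X).prod ν := by
  have := Measure.isProbabilityMeasure_map hX
  have := Measure.isProbabilityMeasure_map (hX.prodMk hN)
  rw [← charFun_eq_prod_iff]
  intro θ
  rw [charFun_apply, integral_map (by fun_prop) (by fun_prop),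
    integral_map (hX.prodMk hN) (by fun_prop), charFun_apply_real, integral_map hX (by fun_prop),
    mul_comm]
  convert! h θ.fst θ.snd using 1
  · refine integral_congr_ae (Eventually.of_forall fun ω ↦ ?_)
    simp only [WithLp.prod_inner_apply]
    rw [← Complex.exp_add]
    simp
    ring_nf
  · simp

open scoped MatrixOrder in
lemma map_add_multivariateGaussian (m : EuclideanSpace ℝ (Fin 3)) (S : Matrix (Fin 3) (Fin 3) ℝ) :
    (multivariateGaussian 0 S).map (fun z ↦ m + z) = multivariateGaussian m S := by
  rw [multivariateGaussian, multivariateGaussian, Measure.map_map (by fun_prop) (by fun_prop)]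
  congr 1
  ext z
  simp

/-- If subtracting `condMean κ Δ X` from `V` leaves a centred Gaussian vector independent of `X`,
then the conditional law of `V` given `X` is the Gaussian kernel. -/
lemma hasCondDistrib_gaussianIncrementKernel {Ω : Type*} {mΩ : MeasurableSpace Ω} {P : Measure Ω}
    [IsProbabilityMeasure P] {κ ρ Δ : ℝ} {X : Ω → ℝ} {V : Ω → EuclideanSpace ℝ (Fin 3)}
    (hX : AEMeasurable X P) (hV : AEMeasurable V P)
    (h : P.map (fun ω ↦ (X ω, V ω - condMean κ Δ (X ω))) =
      (P.map X).prod (multivariateGaussian 0 (condCov κ ρ Δ))) :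
    HasCondDistrib V X (gaussianIncrementKernel κ ρ Δ) P := by
  have := Measure.isProbabilityMeasure_map hX
  have hm := measurable_condMean κ Δ
  have hφ : Measurable fun p : ℝ × EuclideanSpace ℝ (Fin 3) ↦ (p.1, condMean κ Δ p.1 + p.2) := by
    fun_prop
  refine ⟨hX.prodMk hV, ?_⟩
  have e : (fun ω ↦ (X ω, V ω)) =
      (fun p : ℝ × EuclideanSpace ℝ (Fin 3) ↦ (p.1, condMean κ Δ p.1 + p.2)) ∘
        fun ω ↦ (X ω, V ω - condMean κ Δ (X ω)) := by ext <;> simp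
  have hN : AEMeasurable (fun ω ↦ (X ω, V ω - condMean κ Δ (X ω))) P :=
    hX.prodMk (hV.sub (hm.comp_aemeasurable hX))
  rw [e, ← AEMeasurable.map_map_of_aemeasurable hφ.aemeasurable hN, h]
  ext s hs
  rw [Measure.map_apply hφ hs, Measure.prod_apply (hφ hs), Measure.compProd_apply hs]
  refine lintegral_congr fun x ↦ ?_
  change _ = multivariateGaussian (condMean κ Δ x) (condCov κ ρ Δ) _
  rw [← map_add_multivariateGaussian (condMean κ Δ x), Measure.map_apply (by fun_prop)
    (measurable_prodMk_left hs)]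
  rfl

/-! ### The Vasicek process -/

section Vasicek

variable {Ω : Type*} {mΩ : MeasurableSpace Ω} {P : Measure Ω}
  {𝓕 : Filtration ℝ≥0 mΩ} {κ : ℝ} {R W : ℝ≥0 → Ω → ℝ}

/-- No joint measurability of `R` is needed: the equation expresses the time integral through the
values of `R` and `W`. -/
lemma IsVasicekSolution.aemeasurable_timeIntegral (hR : IsVasicekSolution κ R W 𝓕 P) (hκ : κ ≠ 0)
    (hW : StronglyAdapted 𝓕 W) (u : ℝ≥0) : AEMeasurable (timeIntegral R u) P := by
  have hRm (i : ℝ≥0) : Measurable (R i) := ((hR.adapted i).mono (𝓕.le i)).measurable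
  have hWm (i : ℝ≥0) : Measurable (W i) := ((hW i).mono (𝓕.le i)).measurable
  refine AEMeasurable.congr (f := fun ω ↦ (R 0 ω - R u ω + (W u ω - W 0 ω)) / κ)
    (by fun_prop) ?_
  filter_upwards [hR.sde] with ω hω
  rw [hω u]
  field_simp
  ring

/-- Variation of constants along paths: over `[t, t + T]`, the increment of the time integral splits
into a function of `R t` and a functional of the increments of `W` after `t`. -/
lemma IsVasicekSolution.timeIntegral_increment (hR : IsVasicekSolution κ R W 𝓕 P) (hκ : κ ≠ 0)
    (hW : ∀ᵐ ω ∂P, Continuous (W · ω)) (t T : ℝ≥0) :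
    ∀ᵐ ω ∂P, timeIntegral R (t + T) ω - timeIntegral R t ω =
      R t ω * ((1 - Real.exp (-κ * T)) / κ) +
        ∫ s in (0 : ℝ)..T, (W (t + s.toNNReal) ω - W t ω) * Real.exp (-κ * (T - s)) := by
  filter_upwards [hR.cont, hW, hR.sde] with ω hRc hWc hsde
  have hr : Continuous fun s : ℝ ↦ R s.toNNReal ω := hRc.comp continuous_real_toNNReal
  have hinc (s : ℝ≥0) : timeIntegral R (t + s) ω - timeIntegral R t ω =
      ∫ u in (0 : ℝ)..s, R ((t : ℝ) + u).toNNReal ω := by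
    unfold timeIntegral
    rw [intervalIntegral.integral_interval_sub_left (hr.intervalIntegrable _ _)
      (hr.intervalIntegrable _ _),
      intervalIntegral.integral_comp_add_left (fun u ↦ R u.toNNReal ω)]
    simp
  rw [hinc]
  refine integral_eq_of_linear_integral_equation hκ T.coe_nonneg
    (r := fun u ↦ R ((t : ℝ) + u).toNNReal ω) (B := fun s ↦ W (t + s.toNNReal) ω - W t ω)
    (hr.comp (continuous_const.add continuous_id))
    ((hWc.comp (continuous_const.add continuous_real_toNNReal)).sub continuous_const) ?_
  intro s hs
  have h1 := hsde (t + s.toNNReal)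
  have h2 := hsde t
  have h3 := hinc s.toNNReal
  rw [Real.coe_toNNReal s hs.1] at h3
  rw [← h3, Real.toNNReal_add t.coe_nonneg hs.1, Real.toNNReal_coe]
  linear_combination h1 - h2

end Vasicek

/-- Pairing the centred increment vector with `θ` gives a Wiener integral. -/
lemma inner_incrementVector_sub_condMean {Ω : Type*} {mΩ : MeasurableSpace Ω} {P : Measure Ω}
    {𝓕 : Filtration ℝ≥0 mΩ} {κ : ℝ} {R Wr WS : ℝ≥0 → Ω → ℝ}
    (hR : IsVasicekSolution κ R Wr 𝓕 P) (hκ : κ ≠ 0)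
    (hW : ∀ᵐ ω ∂P, Continuous (Wr · ω)) (t T : ℝ≥0) :
    ∀ᵐ ω ∂P, ∀ θ : EuclideanSpace ℝ (Fin 3),
      inner ℝ (incrementVector R WS t T ω - condMean κ T (R t ω)) θ =
        vasicekWeight κ T (θ 0) (θ 1) T * (Wr (t + T) ω - Wr t ω) -
        (∫ s in (0 : ℝ)..T, (Wr (t + s.toNNReal) ω - Wr t ω) *
          ((κ * θ 0 - θ 1) * Real.exp (-κ * (T - s)))) +
        θ 2 * (WS (t + T) ω - WS t ω) := by
  filter_upwards [hR.sde, hR.timeIntegral_increment hκ hW t T] with ω hsde hJ θ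
  have h1 := hsde (t + T)
  have h2 := hsde t
  simp_rw [mul_left_comm _ (κ * θ 0 - θ 1)]
  rw [intervalIntegral.integral_const_mul]
  set Y := ∫ s in (0 : ℝ)..T, (Wr (t + s.toNNReal) ω - Wr t ω) * Real.exp (-κ * (T - s))
  have hD : R (t + T) ω - R t ω = R t ω * (Real.exp (-κ * T) - 1) +
      (Wr (t + T) ω - Wr t ω) - κ * Y := by
    have : κ * (timeIntegral R (t + T) ω - timeIntegral R t ω) =
        R t ω * (1 - Real.exp (-κ * T)) + κ * Y := by
      rw [hJ]; field_simp
    linear_combination h1 - h2 - this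
  simp only [incrementVector, condMean, PiLp.inner_apply, Fin.sum_univ_three, hJ, hD, vasicekWeight]
  simp
  field_simp
  ring

theorem proposition3 {Ω : Type*} {mΩ : MeasurableSpace Ω} (P : Measure Ω) [IsProbabilityMeasure P]
    (𝓕 : Filtration ℝ≥0 mΩ) (κ ρ : ℝ) (hκ : 0 < κ) (Wr WS R : ℝ≥0 → Ω → ℝ)
    (hWr : IsBrownianWrt Wr 𝓕 P) (hWS : IsBrownianWrt WS 𝓕 P)
    (hρ : IsAngleBracket WS Wr (fun t _ ↦ ρ * (t : ℝ)) 𝓕 P)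
    (hR : IsVasicekSolution κ R Wr 𝓕 P)
    (t Δ : ℝ≥0) (ht : 0 < t) (hΔ : 0 < Δ) :
    (condCov κ ρ (Δ : ℝ)).PosSemidef ∧
      HasCondDistrib (incrementVector R WS t Δ) (R t) (gaussianIncrementKernel κ ρ (Δ : ℝ)) P := by
  have hS : (condCov κ ρ (Δ : ℝ)).PosSemidef := by
    refine Matrix.PosSemidef.of_dotProduct_mulVec_nonneg ?_ fun θ ↦ ?_
    · ext i j
      fin_cases i <;> fin_cases j <;> simp [condCov]
    · rw [star_trivial, dotProduct_condCov_mulVec hκ.ne']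
      exact intervalIntegral.integral_nonneg Δ.coe_nonneg fun s _ ↦
        varianceRate_nonneg hWr hWS hρ _ _
  refine ⟨hS, ?_⟩
  have hRm (i : ℝ≥0) : Measurable (R i) := ((hR.adapted i).mono (𝓕.le i)).measurable
  have hWSm (i : ℝ≥0) : Measurable (WS i) := ((hWS.adapted i).mono (𝓕.le i)).measurable
  have hI := hR.aemeasurable_timeIntegral hκ.ne' hWr.adapted
  have hV : AEMeasurable (incrementVector R WS t Δ) P := by
    unfold incrementVector
    refine (WithLp.measurable_toLp 2 (Fin 3 → ℝ)).comp_aemeasurable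
      (aemeasurable_pi_lambda _ fun i ↦ ?_)
    fin_cases i
    · exact ((hRm _).sub (hRm _)).aemeasurable
    · exact (hI _).sub (hI _)
    · exact ((hWSm _).sub (hWSm _)).aemeasurable
  refine hasCondDistrib_gaussianIncrementKernel (hRm t).aemeasurable hV
    (map_prodMk_eq_prod_of_integral_cexp (hRm t).aemeasurable
      (hV.sub ((measurable_condMean κ Δ).comp_aemeasurable (hRm t).aemeasurable)) fun x θ ↦ ?_)
  have key := integral_mul_cexp_wienerIntegral hWr hWS hρ
    (hasDerivAt_vasicekWeight hκ.ne' Δ (θ 0) (θ 1)) (by fun_prop) (θ 2) t Δ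
    (G := fun ω ↦ Complex.exp ((x * R t ω : ℝ) * Complex.I))
    ((by fun_prop : Continuous fun y : ℝ ↦
      Complex.exp ((x * y : ℝ) * Complex.I)).comp_stronglyMeasurable (hR.adapted t))
    (fun ω ↦ (Complex.norm_exp_ofReal_mul_I _).le)
  rw [← dotProduct_condCov_mulVec hκ.ne'] at key
  rw [charFun_multivariateGaussian hS]
  convert! key using 1
  · refine integral_congr_ae ?_
    filter_upwards [inner_incrementVector_sub_condMean (WS := WS) hR hκ.ne' hWr.isBrownian.cont t Δ]
      with ω hω
    rw [hω θ]
  · simp
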